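/- Let $n\ge 1$, let $\sigma$ be an $n$-cycle in the symmetric group on $\{1,\dots,n\}$ (the identity if $n=1$), and let $P_n^\sigma=\{0,1,\dots,n\}$ be the quandle with $x*y=x$ for $y\neq 0$, $x*0=\sigma(x)$ for $x\ne 0$, and $0*0=0$. Let $\theta:P_n^\sigma\times P_n^\sigma\to\langle t^k:k\in\mathbb Z\rangle$ be the quandle 2-cocycle $\theta=t^{\sum_{i=1}^n\chi_{(0,i)}}$, that is, $\theta(0,a)=t$ for $a\ne 0$ and $\theta=1$ on all other pairs. For an oriented planar link diagram $D$, the quandle cocycle invariant is $$\Phi_\theta(D)=\sum_{P_n^\sigma\text{-colorings}}\ \prod_{\text{crossings }c}\theta(x_c,y_c)^{\epsilon_c}\in\mathbb Z[\langle t\rangle],$$ where $\epsilon_c$ is the sign of $c$, $y_c$ is the color of its over arc and $x_c$ is the color of the under arc on the right of the over arc; in a coloring, the under arc on the left of the over arc has color $x_c*y_c$. Let $L=K_1\cup K_2$ be an oriented link with two components, given by any planar diagram. Its linking number $lk=lk(K_1,K_2)$ is half of the number of positive minus the number of negative crossings between $K_1$ and $K_2$; it is an integer, and it equals the number of positive minus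 the number of negative crossings at which $K_1$ passes under $K_2$, and likewise with $K_1$ and $K_2$ exchanged. Then $\Phi_\theta(L)$ is determined by $lk$: two such links with the same linking number have the same invariant. Explicitly, $$\Phi_\theta(L)=\begin{cases}1+n^2+2n\,t^{lk}&\text{if } n\mid lk,\\ 1+n^2&\text{otherwise.}\end{cases}$$ -/

import Mathlib

/-! ### Quandle 2-cocycles

For a quandle `X` we use Mathlib's `Quandle`, whose operation is written as a left action:
`Shelf.act y x` is the product `x * y` of the usual right-handed notation. -/

/-- A quandle 2-cocycle of `X` with coefficients in an abelian group `A` written multiplicatively: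
`f (x, y) f (x * y, z) = f (x, z) f (x * z, y * z)` and `f (x, x) = 1`. -/
structure QuandleCocycle (X : Type) [Quandle X] (A : Type) [CommGroup A] where
  toFun : X → X → A
  cocycle : ∀ x y z : X,
    toFun x y * toFun (Shelf.act y x) z = toFun x z * toFun (Shelf.act z x) (Shelf.act z y)
  diag : ∀ x : X, toFun x x = 1

/-! ### Oriented link diagrams -/

/-- The two strands at a crossing. -/
inductive Strand
  | over
  | under
  deriving DecidableEq

instance : Fintype Strand := ⟨{.over, .under}, by rintro (_ | _) <;> simp⟩

/-- The two half-edges of a strand at a crossing: the one along which the orientation leaves the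
crossing, and the one along which it arrives. -/
inductive HalfEdge
  | outgoing
  | incoming
  deriving DecidableEq

instance : Fintype HalfEdge := ⟨{.outgoing, .incoming}, by rintro (_ | _) <;> simp⟩

/-- Exchange outgoing and incoming. -/
def HalfEdge.flip : HalfEdge → HalfEdge
  | .outgoing => .incoming
  | .incoming => .outgoing

/-- The signed Gauss code of an oriented link diagram with `m` components `0, …, m - 1`.

A passage `(c, s)` is the event that a component runs through the crossing `c` along the strand `s`;
`next` sends each passage to the following one along the oriented component. Components are the
cycles of `next`; a label in `Fin m` that belongs to no passage is a component which is drawn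
without any crossing. -/
structure GaussCode (m : ℕ) where
  Crossing : Type
  [fintypeCrossing : Fintype Crossing]
  sign : Crossing → ℤˣ
  next : Equiv.Perm (Crossing × Strand)
  component : Crossing × Strand → Fin m
  component_eq_iff : ∀ p q, component p = component q ↔ next.SameCycle p q

attribute [instance] GaussCode.fintypeCrossing

namespace GaussCode

variable {m : ℕ} (D : GaussCode m)

/-- A strand running through a crossing. -/
abbrev Passage : Type := D.Crossing × Strand

/-- The half-edges of the projection, which is a 4-valent graph with the crossings as vertices. -/
abbrev Dart : Type := D.Passage × HalfEdge

/-- The other half of the same edge: the edge that leaves the passage `p` arrives at `next p`. -/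
def edgeSwap : Equiv.Perm D.Dart where
  toFun
    | (p, .outgoing) => (D.next p, .incoming)
    | (p, .incoming) => (D.next.symm p, .outgoing)
  invFun
    | (p, .outgoing) => (D.next p, .incoming)
    | (p, .incoming) => (D.next.symm p, .outgoing)
  left_inv := by rintro ⟨p, _ | _⟩ <;> simp
  right_inv := by rintro ⟨p, _ | _⟩ <;> simp

/-- The next half-edge at the same crossing in counterclockwise order. At a positive crossing this
order is over-out, under-out, over-in, under-in; at a negative crossing it is
under-out, over-out, under-in, over-in. -/
def rotate : Equiv.Perm D.Dart where
  toFun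
    | ((c, .over), h) => ((c, .under), if D.sign c = 1 then h else h.flip)
    | ((c, .under), h) => ((c, .over), if D.sign c = 1 then h.flip else h)
  invFun
    | ((c, .over), h) => ((c, .under), if D.sign c = 1 then h.flip else h)
    | ((c, .under), h) => ((c, .over), if D.sign c = 1 then h else h.flip)
  left_inv := by
    rintro ⟨⟨c, _ | _⟩, _ | _⟩ <;> by_cases h : D.sign c = 1 <;> simp [h, HalfEdge.flip]
  right_inv := by
    rintro ⟨⟨c, _ | _⟩, _ | _⟩ <;> by_cases h : D.sign c = 1 <;> simp [h, HalfEdge.flip]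

/-- Walking along the boundary of a face. -/
def facePerm : Equiv.Perm D.Dart := D.edgeSwap.trans D.rotate

/-- The faces (regions) of the projection on the closed oriented surface that carries it. -/
def Face : Type := Quotient (Equiv.Perm.SameCycle.setoid D.facePerm)

/-- Two crossings are adjacent if an edge of the projection joins them. -/
def projection : SimpleGraph D.Crossing :=
  SimpleGraph.fromRel fun c d => ∃ s s', D.next (c, s) = (d, s')

/-- The projection is drawn on the sphere (equivalently, in the plane): `V - E + F = 2` on every
connected component of the projection. As `V - E + F ≤ 2` always holds for a connected projection,
this says that the sum of these numbers is twice the number of connected components. The edges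
correspond to the passages at which they begin. -/
def IsPlanar : Prop :=
  (Nat.card D.Crossing : ℤ) - Nat.card D.Passage + Nat.card D.Face
    = 2 * Nat.card D.projection.ConnectedComponent

end GaussCode

/-- An oriented (planar) diagram of a classical link with `m` components. -/
structure LinkDiagram (m : ℕ) extends GaussCode m where
  planar : toGaussCode.IsPlanar

namespace LinkDiagram

variable {m : ℕ} (D : LinkDiagram m)

/-- The edges of the diagram: those leaving a passage, and the components without crossings. -/
abbrev Edge : Type := D.Passage ⊕ {i : Fin m // ∀ p, D.component p ≠ i}

/-- The edges `a` and `b` are consecutive along the over strand of some crossing. -/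
def JoinedOver (a b : D.Edge) : Prop :=
  ∃ c, a = Sum.inl (D.next.symm (c, .over)) ∧ b = Sum.inl (c, .over)

/-- The arcs of the diagram: edges are glued at overpasses, and arcs end at underpasses. -/
def Arc : Type := Quot D.JoinedOver

/-- The arc that contains the edge which leaves the passage `p`. -/
def arcFrom (p : D.Passage) : D.Arc := Quot.mk _ (Sum.inl p)

/-- The over arc of a crossing. -/
def overArc (c : D.Crossing) : D.Arc := D.arcFrom (c, .over)

/-- The under arc at `c` from which the orientation normal of the over arc points away, that is,
the under arc to the right of the over arc: the one arriving at a positive crossing, and the one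
leaving a negative crossing. -/
def sourceArc (c : D.Crossing) : D.Arc :=
  if D.sign c = 1 then D.arcFrom (D.next.symm (c, .under)) else D.arcFrom (c, .under)

/-- The other under arc at `c`, towards which the normal of the over arc points. -/
def targetArc (c : D.Crossing) : D.Arc :=
  if D.sign c = 1 then D.arcFrom (c, .under) else D.arcFrom (D.next.symm (c, .under))

instance : Finite D.Arc := inferInstanceAs (Finite (Quot _))

/-- The `X`-colorings of a diagram: if the source and over arcs of a crossing are colored `x` and
`y`, then its target arc is colored `x * y`. -/
def Coloring (X : Type) [Quandle X] : Type :=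
  {f : D.Arc → X // ∀ c, f (D.targetArc c) = Shelf.act (f (D.overArc c)) (f (D.sourceArc c))}

noncomputable instance (X : Type) [Quandle X] [Finite X] : Fintype (D.Coloring X) :=
  haveI : Finite (D.Coloring X) := inferInstanceAs (Finite {_f : D.Arc → X // _})
  Fintype.ofFinite _

/-- The `θ`-weight of a colored diagram: the product of `θ (x, y) ^ ε` over all crossings, with `x`
the color of the source arc, `y` the color of the over arc and `ε` the sign of the crossing. -/
def weight {X A : Type} [Quandle X] [CommGroup A] (θ : QuandleCocycle X A) (f : D.Coloring X) : A :=
  ∏ c, θ.toFun (f.1 (D.sourceArc c)) (f.1 (D.overArc c)) ^ (D.sign c : ℤ)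

/-- The quandle cocycle invariant, the formal sum in `ℤ[A]` of the weights of all colorings. -/
noncomputable def cocycleInvariant {X A : Type} [Quandle X] [Finite X] [CommGroup A]
    (θ : QuandleCocycle X A) : MonoidAlgebra ℤ A :=
  ∑ f : D.Coloring X, MonoidAlgebra.of ℤ A (D.weight θ f)

/-- The number of positive minus the number of negative crossings at which component `i` passes
under component `j`. -/
def signedUnder (i j : Fin m) : ℤ :=
  ∑ c with D.component (c, .under) = i ∧ D.component (c, .over) = j, (D.sign c : ℤ)

/-- The linking number of two distinct components: half of the number of positive minus the number
of negative crossings between them. -/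
def linkingNumber (i j : Fin m) : ℤ :=
  (D.signedUnder i j + D.signedUnder j i) / 2

end LinkDiagram

/-! ### The quandle `P_n^σ` and its cocycle -/

/-- The underlying set `{0, 1, …, n}` of `P_n^σ`: `none` is `0`, and `some i` for `i : Fin n` are the
`n` positive elements, on which `σ` acts. -/
def PQuandle {n : ℕ} (_σ : Equiv.Perm (Fin n)) : Type := Option (Fin n)

namespace PQuandle

variable {n : ℕ} (σ : Equiv.Perm (Fin n))

instance : Fintype (PQuandle σ) := inferInstanceAs (Fintype (Option (Fin n)))

instance : DecidableEq (PQuandle σ) := inferInstanceAs (DecidableEq (Option (Fin n)))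

/-- The element `0`. -/
def zero : PQuandle σ := (none : Option (Fin n))

/-- The positive elements. -/
def pos (i : Fin n) : PQuandle σ := (some i : Option (Fin n))

/-- `op σ x y` is `x * y`: it is `x` if `y ≠ 0`, `σ x` if `y = 0` and `x ≠ 0`, and `0` if both are
`0`. -/
def op : PQuandle σ → PQuandle σ → PQuandle σ
  | x, some _ => x
  | some i, none => pos σ (σ i)
  | none, none => zero σ

instance : Quandle (PQuandle σ) where
  act y x := op σ x y
  self_distrib := by
    rintro (_ | x) (_ | y) (_ | z) <;> rfl
  invAct y x := op σ.symm x y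
  left_inv := by
    rintro (_ | y) (_ | x)
    · rfl
    · exact congrArg some (σ.symm_apply_apply x)
    · rfl
    · rfl
  right_inv := by
    rintro (_ | y) (_ | x)
    · rfl
    · exact congrArg some (σ.apply_symm_apply x)
    · rfl
    · rfl
  fix := by
    rintro (_ | x) <;> rfl

/-- The characteristic function `χ_(a,b)` of the pair `(a, b)`. -/
def chi (a b x y : PQuandle σ) : ℤ := if x = a ∧ y = b then 1 else 0

/-- The exponent `∑ i, χ_(0,i)` summed over the positive elements `i`. -/
def exponent (x y : PQuandle σ) : ℤ := ∑ i : Fin n, chi σ (zero σ) (pos σ i) x y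

theorem exponent_pos (i : Fin n) (y : PQuandle σ) : exponent σ (pos σ i) y = 0 := by
  simp [exponent, chi, pos, zero]

theorem exponent_zero_zero : exponent σ (zero σ) (zero σ) = 0 := by
  simp [exponent, chi, pos, zero]

theorem exponent_zero_pos (j : Fin n) : exponent σ (zero σ) (pos σ j) = 1 := by
  have h : ∀ i : Fin n, pos σ j = pos σ i ↔ j = i := fun i => Option.some_inj
  simp [exponent, chi, h]

/-- The cocycle `θ = t ^ (∑ i, χ_(0,i))` with values in the infinite cyclic group generated by `t`,
where `t ^ k` is `Multiplicative.ofAdd k`. -/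
def theta : QuandleCocycle (PQuandle σ) (Multiplicative ℤ) where
  toFun x y := Multiplicative.ofAdd (exponent σ x y)
  cocycle := by
    have h0 := exponent_zero_zero σ
    have h1 := exponent_zero_pos σ
    have h2 := exponent_pos σ
    intro x y z
    rw [← ofAdd_add, ← ofAdd_add]
    congr 1
    change exponent σ x y + exponent σ (op σ x y) z =
      exponent σ x z + exponent σ (op σ x z) (op σ y z)
    rcases x with _ | i <;> rcases y with _ | j <;> rcases z with _ | k
    · rfl
    · exact (congrArg₂ _ h0 (h1 k)).trans ((add_comm _ _).trans (congrArg₂ _ (h1 k) h0).symm)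
    · exact (congrArg₂ _ (h1 j) h0).trans
        ((add_comm _ _).trans (congrArg₂ _ h0 (h1 (σ j))).symm)
    · exact (congrArg₂ _ (h1 j) (h1 k)).trans (congrArg₂ _ (h1 k) (h1 j)).symm
    · exact (congrArg₂ _ (h2 i _) (h2 (σ i) _)).trans (congrArg₂ _ (h2 i _) (h2 (σ i) _)).symm
    · exact (congrArg₂ _ (h2 i _) (h2 (σ i) _)).trans (congrArg₂ _ (h2 i _) (h2 i _)).symm
    · exact (congrArg₂ _ (h2 i _) (h2 i _)).trans (congrArg₂ _ (h2 i _) (h2 (σ i) _)).symm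
    · exact (congrArg₂ _ (h2 i _) (h2 i _)).trans (congrArg₂ _ (h2 i _) (h2 i _)).symm
  diag := by
    rintro (_ | x)
    · exact congrArg Multiplicative.ofAdd (exponent_zero_zero σ)
    · exact congrArg Multiplicative.ofAdd (exponent_pos σ x _)

end PQuandle

/-- The element `t ^ k` of the group ring `ℤ[⟨t⟩]`. -/
noncomputable def tPow (k : ℤ) : MonoidAlgebra ℤ (Multiplicative ℤ) :=
  MonoidAlgebra.of ℤ (Multiplicative ℤ) (Multiplicative.ofAdd k)

/-! Write `P_n^σ` as `0` together with a copy of `ZMod n` on which `σ` adds 1. Being `0` is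
preserved at every crossing, so each component is either entirely `0` or entirely positive. Along a
positive component the color changes only on passing under a `0`-component, by the sign of the
crossing. Hence a coloring is determined by its colors on one base edge per component. Such base
colors extend exactly when, for each positive component, the total change around it vanishes mod
`n`. The weight counts, with sign, the underpasses of `0`-components below positive ones. This gives
`cocycleInvariant_theta` for any number of components.

With two components, both `0` contributes 1, both positive contributes `n ^ 2`, and each mixed case
contributes `n` equal terms under a divisibility condition. There the condition and the exponent
involve opposite counts, `signedUnder 1 0` and `signedUnder 0 1`. That these agree
(`signedUnder_symm`) is the one place where planarity enters: Euler's formula forces the first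
rational homology to vanish, so each component has a winding number function `w` on the faces, and
the changes of `w` along another component cancel. -/

namespace GaussCode

/-! ### Rational homology of the projection and winding numbers -/

variable {m : ℕ} (D : GaussCode m)

instance : Finite D.Face := Quotient.finite _

noncomputable instance : Fintype D.Face := Fintype.ofFinite _

/-- The face to the right of a half-edge that is directed away from its crossing. -/
def face (d : D.Dart) : D.Face := Quotient.mk _ d

theorem edgeSwap_edgeSwap (d : D.Dart) : D.edgeSwap (D.edgeSwap d) = d := by
  rcases d with ⟨p, _ | _⟩ <;> simp [edgeSwap]

theorem face_rotate (d : D.Dart) : D.face (D.rotate d) = D.face (D.edgeSwap d) := by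
  refine Quotient.sound (Equiv.Perm.SameCycle.symm ⟨1, ?_⟩)
  simp [facePerm, edgeSwap_edgeSwap]

theorem rotate_over (c : D.Crossing) (h : HalfEdge) :
    D.rotate ((c, .over), h) = ((c, .under), if D.sign c = 1 then h else h.flip) := rfl

theorem rotate_under (c : D.Crossing) (h : HalfEdge) :
    D.rotate ((c, .under), h) = ((c, .over), if D.sign c = 1 then h.flip else h) := rfl

theorem edgeSwap_outgoing (p : D.Passage) :
    D.edgeSwap (p, .outgoing) = (D.next p, .incoming) := rfl

theorem edgeSwap_incoming (p : D.Passage) :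
    D.edgeSwap (p, .incoming) = (D.next.symm p, .outgoing) := rfl

/-- The cellular boundary from faces to edges: the value on an edge is the difference between its
two sides. -/
def faceBoundary : (D.Face → ℚ) →ₗ[ℚ] (D.Passage → ℚ) where
  toFun w p := w (D.face (p, .outgoing)) - w (D.face (D.next p, .incoming))
  map_add' _ _ := funext fun _ => add_sub_add_comm _ _ _ _
  map_smul' _ _ := funext fun _ => (mul_sub _ _ _).symm

theorem faceBoundary_apply (w : D.Face → ℚ) (p : D.Passage) :
    D.faceBoundary w p = w (D.face (p, .outgoing)) - w (D.face (D.next p, .incoming)) := rfl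

/-- The coboundary from crossings to edges. -/
def crossingCoboundary : (D.Crossing → ℚ) →ₗ[ℚ] (D.Passage → ℚ) where
  toFun g p := g (D.next p).1 - g p.1
  map_add' _ _ := funext fun _ => add_sub_add_comm _ _ _ _
  map_smul' _ _ := funext fun _ => (mul_sub _ _ _).symm

theorem crossingCoboundary_apply (g : D.Crossing → ℚ) (p : D.Passage) :
    D.crossingCoboundary g p = g (D.next p).1 - g p.1 := rfl

theorem faceBoundary_out (w : D.Face → ℚ) (p : D.Passage) :
    D.faceBoundary w p = w (D.face (p, .outgoing)) - w (D.face (D.rotate (p, .outgoing))) := by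
  rw [faceBoundary_apply, face_rotate, edgeSwap_outgoing]

theorem faceBoundary_in (w : D.Face → ℚ) (p : D.Passage) :
    D.faceBoundary w (D.next.symm p) =
      w (D.face (D.rotate (p, .incoming))) - w (D.face (p, .incoming)) := by
  rw [faceBoundary_apply, face_rotate, edgeSwap_incoming, Equiv.apply_symm_apply]

theorem sum_strand {M : Type*} [AddCommMonoid M] (f : Strand → M) :
    ∑ s, f s = f .over + f .under := by
  have : (Finset.univ : Finset Strand) = {.over, .under} := rfl
  rw [this, Finset.sum_pair (by simp)]

/-- The boundary of a boundary vanishes: the four edge terms are differences of adjacent corners and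
telescope once around the crossing. -/
theorem faceBoundary_divergence (w : D.Face → ℚ) (c : D.Crossing) :
    ∑ s, (D.faceBoundary w (D.next.symm (c, s)) - D.faceBoundary w (c, s)) = 0 := by
  rw [sum_strand, faceBoundary_in, faceBoundary_in, faceBoundary_out, faceBoundary_out]
  by_cases h : D.sign c = 1 <;> simp [rotate_over, rotate_under, h, HalfEdge.flip] <;> ring

/-- Summation by parts moves the difference from `g` to the boundary of `w`, which is
divergence-free. -/
theorem sum_faceBoundary_mul_coboundary (w : D.Face → ℚ) (g : D.Crossing → ℚ) :
    ∑ p, D.faceBoundary w p * D.crossingCoboundary g p = 0 := by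
  have h : ∑ p, D.faceBoundary w p * g (D.next p).1 =
      ∑ p, D.faceBoundary w (D.next.symm p) * g p.1 :=
    Fintype.sum_equiv D.next _ _ fun p => by simp
  simp only [crossingCoboundary_apply, mul_sub, Finset.sum_sub_distrib, h]
  rw [← Finset.sum_sub_distrib, Fintype.sum_prod_type]
  refine Finset.sum_eq_zero fun c _ => ?_
  simp only [← sub_mul, ← Finset.sum_mul, D.faceBoundary_divergence w c, zero_mul]

theorem eq_of_reachable {g : D.Crossing → ℚ} (hg : D.crossingCoboundary g = 0)
    {c d : D.Crossing} (h : D.projection.Reachable c d) : g c = g d := by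
  have key : ∀ p, g (D.next p).1 = g p.1 := fun p => sub_eq_zero.1 (congrFun hg p)
  obtain ⟨w⟩ := h
  induction w with
  | nil => rfl
  | cons hadj _ ih =>
    refine Eq.trans ?_ ih
    rw [projection, SimpleGraph.fromRel_adj] at hadj
    obtain ⟨-, ⟨s, s', h⟩ | ⟨s, s', h⟩⟩ := hadj
    · exact ((congrArg (fun x => g x.1) h).symm.trans (key (_, s))).symm
    · exact (congrArg (fun x => g x.1) h).symm.trans (key (_, s))

theorem finrank_ker_crossingCoboundary_le :
    Module.finrank ℚ (LinearMap.ker D.crossingCoboundary) ≤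
      Nat.card D.projection.ConnectedComponent := by
  classical
  have : Fintype D.projection.ConnectedComponent := Fintype.ofFinite _
  rw [Nat.card_eq_fintype_card, ← Module.finrank_fintype_fun_eq_card (R := ℚ)]
  refine LinearMap.finrank_le_finrank_of_injective
    (f := (LinearMap.funLeft ℚ ℚ
      (fun κ : D.projection.ConnectedComponent => Quot.out κ)).domRestrict _) ?_
  rw [← LinearMap.ker_eq_bot, LinearMap.ker_eq_bot']
  rintro ⟨g, hg⟩ h
  ext c
  have hc : g (Quot.out (D.projection.connectedComponentMk c)) = 0 := congrFun h _
  exact (D.eq_of_reachable hg (SimpleGraph.ConnectedComponent.exact (Quot.out_eq _).symm)).trans hc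

/-- Neighbouring corners at a crossing are separated by an edge across which `w` does not jump. -/
theorem eq_of_faceBoundary_eq_zero {w : D.Face → ℚ} (hw : D.faceBoundary w = 0)
    (c : D.Crossing) (s : Strand) (h : HalfEdge) :
    w (D.face ((c, s), h)) = w (D.face ((c, .over), .outgoing)) := by
  have hr : ∀ d, w (D.face (D.rotate d)) = w (D.face d) := by
    rintro ⟨p, _ | _⟩
    · exact (sub_eq_zero.1 ((D.faceBoundary_out w p).symm.trans (congrFun hw p))).symm
    · exact sub_eq_zero.1 ((D.faceBoundary_in w p).symm.trans (congrFun hw _))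
  have h1 := hr ((c, .over), .outgoing)
  have h2 := hr ((c, .under), .outgoing)
  have h3 := hr ((c, .over), .incoming)
  have h4 := hr ((c, .under), .incoming)
  by_cases hc : D.sign c = 1 <;> simp [rotate_over, rotate_under, hc, HalfEdge.flip]
    at h1 h2 h3 h4 <;> cases s <;> cases h <;> simp_all

/-- Reading `w` off at one corner of each crossing embeds this kernel into the functions on
crossings that are constant along edges. Injectivity holds because every face has a corner. -/
theorem finrank_ker_faceBoundary_le :
    Module.finrank ℚ (LinearMap.ker D.faceBoundary) ≤
      Nat.card D.projection.ConnectedComponent := by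
  refine le_trans ?_ D.finrank_ker_crossingCoboundary_le
  let L : LinearMap.ker D.faceBoundary →ₗ[ℚ] LinearMap.ker D.crossingCoboundary :=
    LinearMap.codRestrict _ ((LinearMap.funLeft ℚ ℚ
      (fun c : D.Crossing => D.face ((c, .over), .outgoing))).domRestrict _) (by
        rintro ⟨w, hw⟩
        ext p
        change w (D.face (((D.next p).1, .over), .outgoing)) -
          w (D.face ((p.1, .over), .outgoing)) = 0
        rw [← D.eq_of_faceBoundary_eq_zero hw (D.next p).1 (D.next p).2 .incoming,
          ← D.eq_of_faceBoundary_eq_zero hw p.1 p.2 .outgoing]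
        exact neg_eq_zero.1 ((neg_sub _ _).trans (congrFun hw p)))
  refine LinearMap.finrank_le_finrank_of_injective (f := L) ?_
  rw [← LinearMap.ker_eq_bot, LinearMap.ker_eq_bot']
  rintro ⟨w, hw⟩ h
  ext F
  induction F using Quotient.inductionOn with
  | h d =>
    obtain ⟨⟨c, s⟩, o⟩ := d
    refine (D.eq_of_faceBoundary_eq_zero hw c s o).trans ?_
    exact congrFun (congrArg Subtype.val h) c

/-- With `k` connected components the two ranks are at least `F - k` and `V - k`. By planarity their
sum is at least `E`, and the ranges meet in 0 because they are orthogonal for a positive definite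
form. -/
theorem range_sup_range_eq_top (hD : D.IsPlanar) :
    LinearMap.range D.faceBoundary ⊔ LinearMap.range D.crossingCoboundary = ⊤ := by
  refine Submodule.eq_top_of_disjoint _ _ ?_ ?_
  · have h1 := LinearMap.finrank_range_add_finrank_ker D.faceBoundary
    have h2 := LinearMap.finrank_range_add_finrank_ker D.crossingCoboundary
    have h3 := D.finrank_ker_faceBoundary_le
    have h4 := D.finrank_ker_crossingCoboundary_le
    rw [Module.finrank_fintype_fun_eq_card, ← Nat.card_eq_fintype_card] at h1 h2 ⊢
    unfold IsPlanar at hD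
    omega
  · rw [Submodule.disjoint_def]
    rintro _ ⟨w, rfl⟩ ⟨g, hg⟩
    have h := D.sum_faceBoundary_mul_coboundary w g
    rw [hg, Finset.sum_eq_zero_iff_of_nonneg fun _ _ => mul_self_nonneg _] at h
    exact funext fun p => mul_self_eq_zero.1 (h p (Finset.mem_univ p))

/-- On a planar diagram every cycle of edges bounds. -/
theorem exists_faceBoundary_eq (hD : D.IsPlanar) (u : D.Passage → ℚ)
    (hu : ∀ g, ∑ p, u p * D.crossingCoboundary g p = 0) : ∃ w, D.faceBoundary w = u := by
  have hmem : u ∈ LinearMap.range D.faceBoundary ⊔ LinearMap.range D.crossingCoboundary := by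
    rw [D.range_sup_range_eq_top hD]; trivial
  obtain ⟨_, ⟨w, rfl⟩, _, ⟨g, rfl⟩, rfl⟩ := Submodule.mem_sup.1 hmem
  refine ⟨w, ?_⟩
  -- Pairing `u` with its coboundary part `δg` leaves the sum of squares of `δg`, so that part is 0.
  have h := hu g
  simp only [Pi.add_apply, add_mul, Finset.sum_add_distrib,
    D.sum_faceBoundary_mul_coboundary w g, zero_add] at h
  rw [Finset.sum_eq_zero_iff_of_nonneg fun _ _ => mul_self_nonneg _] at h
  exact funext fun p => by simp [mul_self_eq_zero.1 (h p (Finset.mem_univ p))]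

theorem component_next (p : D.Passage) : D.component (D.next p) = D.component p :=
  ((D.component_eq_iff _ _).2 ⟨1, by simp⟩).symm

theorem component_next_symm (p : D.Passage) : D.component (D.next.symm p) = D.component p := by
  simpa using (D.component_next (D.next.symm p)).symm

theorem sum_component_sub_prev {A : Type*} [AddCommGroup A] (i : Fin m) (φ : D.Passage → A) :
    ∑ p with D.component p = i, (φ p - φ (D.next.symm p)) = 0 := by
  rw [Finset.sum_sub_distrib, sub_eq_zero]
  refine Finset.sum_equiv D.next (fun p => ?_) fun p _ => ?_
  · simp [D.component_next]
  · simp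

/-- Every component has a winding number function on the faces. -/
theorem exists_winding (hD : D.IsPlanar) (i : Fin m) :
    ∃ w, ∀ p, D.faceBoundary w p = if D.component p = i then 1 else 0 := by
  obtain ⟨w, hw⟩ := D.exists_faceBoundary_eq hD (fun p => if D.component p = i then 1 else 0) (by
    intro g
    simp only [crossingCoboundary_apply, ite_mul, one_mul, zero_mul]
    rw [← Finset.sum_filter, ← neg_eq_zero, ← Finset.sum_neg_distrib]
    have h := D.sum_component_sub_prev i fun p => -g (D.next p).1
    simp only [Equiv.apply_symm_apply] at h
    rw [← h]
    exact Finset.sum_congr rfl fun p _ => by ring)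
  exact ⟨w, congrFun hw⟩

end GaussCode

/-! ### Symmetry of the signed crossing counts -/

namespace LinkDiagram

variable {m : ℕ} (D : LinkDiagram m)

/-- Follow the winding number of component `i` on the right side of component `j`. It changes by the
sign of the crossing when `j` passes over `i` and by minus the sign when `j` passes under `i`;
around the closed component the changes sum to 0. -/
theorem signedUnder_symm (i j : Fin m) : D.signedUnder i j = D.signedUnder j i := by
  obtain ⟨w, hw⟩ := D.exists_winding D.planar i
  have hin : ∀ p, w (D.face (D.rotate (p, .incoming))) - w (D.face (p, .incoming)) =
      if D.component p = i then 1 else 0 := fun p => by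
    rw [← D.faceBoundary_in, hw, D.component_next_symm]
  have hout : ∀ p, w (D.face (p, .outgoing)) - w (D.face (D.rotate (p, .outgoing))) =
      if D.component p = i then 1 else 0 := fun p => by rw [← D.faceBoundary_out, hw]
  have hover : ∀ c, w (D.face ((c, .over), .outgoing)) -
      w (D.face (D.next.symm (c, .over), .outgoing)) =
        if D.component (c, .under) = i then ((D.sign c : ℤ) : ℚ) else 0 := by
    intro c
    -- The face to the right of the arriving edge is re-expressed as a corner at `c`, so that only
    -- jumps across the under strand remain.
    rw [← D.edgeSwap_incoming, ← D.face_rotate]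
    have h1 := hin (c, .under)
    have h2 := hout (c, .under)
    rcases Int.units_eq_one_or (D.sign c) with h | h <;>
      simp [GaussCode.rotate_over, GaussCode.rotate_under, h, HalfEdge.flip] at h1 h2 ⊢ <;>
      split_ifs at * <;> linarith
  have hunder : ∀ c, w (D.face ((c, .under), .outgoing)) -
      w (D.face (D.next.symm (c, .under), .outgoing)) =
        if D.component (c, .over) = i then -((D.sign c : ℤ) : ℚ) else 0 := by
    intro c
    rw [← D.edgeSwap_incoming, ← D.face_rotate]
    have h1 := hin (c, .over)
    have h2 := hout (c, .over)
    rcases Int.units_eq_one_or (D.sign c) with h | h <;>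
      simp [GaussCode.rotate_over, GaussCode.rotate_under, h, HalfEdge.flip] at h1 h2 ⊢ <;>
      split_ifs at * <;> linarith
  have h := D.sum_component_sub_prev j fun p => w (D.face (p, .outgoing))
  rw [Finset.sum_filter, Fintype.sum_prod_type] at h
  simp only [GaussCode.sum_strand, hover, hunder] at h
  rw [← Int.cast_inj (α := ℚ), ← sub_eq_zero, ← h, signedUnder, signedUnder]
  push_cast
  rw [Finset.sum_filter, Finset.sum_filter, ← Finset.sum_sub_distrib]
  refine Finset.sum_congr rfl fun c _ => ?_
  generalize D.component (c, .under) = a, D.component (c, .over) = b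
  split_ifs <;> grind

end LinkDiagram

/-! ### Sums along cycles of a permutation -/

namespace Equiv.Perm

variable {P A : Type*} [AddCommGroup A]

theorem isCycleOn_filter_sameCycle [Fintype P] [DecidableEq P] (π : Perm P) (c : P) :
    π.IsCycleOn (({p | π.SameCycle c p} : Finset P) : Set P) := by
  refine ⟨⟨fun p hp => ?_, π.injective.injOn, fun p hp => ⟨π.symm p, ?_, by simp⟩⟩,
    fun p hp q hq => ?_⟩
  · simpa using hp
  · simpa using hp
  · rw [Finset.mem_coe, Finset.mem_filter_univ] at hp hq
    exact hp.symm.trans hq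

theorem sum_range_pow_eq_sum_sameCycle [Fintype P] [DecidableEq P] (π : Perm P) (h : P → A)
    (c : P) :
    ∑ j ∈ Finset.range (Finset.card {p | π.SameCycle c p}), h ((π ^ (j + 1)) c) =
      ∑ p with π.SameCycle c p, h p := by
  have hon := isCycleOn_filter_sameCycle π c
  have himage : (Finset.range (Finset.card {p | π.SameCycle c p})).image
      (fun j => (π ^ (j + 1)) c) = ({p | π.SameCycle c p} : Finset P) := by
    ext p
    simp only [Finset.mem_image, Finset.mem_range]
    constructor
    · rintro ⟨j, -, rfl⟩
      simp [sameCycle_pow_right, SameCycle.refl]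
    · intro hp
      obtain ⟨j, hj, hjp⟩ := hon.exists_pow_eq (a := π c) (b := p) (by simp [SameCycle.refl]) hp
      exact ⟨j, hj, by rw [pow_succ, mul_apply, hjp]⟩
  rw [← himage, Finset.sum_image]
  · rw [himage]
  · rw [← Finset.card_image_iff, himage, Finset.card_range]

/-- A return time is a multiple of the cycle length, so the sum splits into full turns. -/
theorem sum_range_pow_eq_zero [Fintype P] [DecidableEq P] {π : Perm P} {h : P → A}
    (hsum : ∀ c, ∑ p with π.SameCycle c p, h p = 0) {c : P} {d : ℕ} (hd : (π ^ d) c = c) :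
    ∑ j ∈ Finset.range d, h ((π ^ (j + 1)) c) = 0 := by
  have hon := isCycleOn_filter_sameCycle π c
  obtain ⟨q, rfl⟩ := (hon.pow_apply_eq (a := c) (by simp [SameCycle.refl])).1 hd
  clear hd
  induction q with
  | zero => simp
  | succ q ih =>
    rw [Nat.mul_succ, Finset.sum_range_add, ih, zero_add, ← hsum c,
      ← sum_range_pow_eq_sum_sameCycle]
    refine Finset.sum_congr rfl fun j _ => congrArg h ?_
    rw [show Finset.card {p | π.SameCycle c p} * q + j + 1 =
      (j + 1) + Finset.card {p | π.SameCycle c p} * q by ring, pow_add, mul_apply,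
      (hon.pow_apply_eq (a := c) (by simp [SameCycle.refl])).2 (dvd_mul_right _ _)]

/-- A function whose sum over every cycle vanishes is a coboundary. -/
theorem exists_potential [Fintype P] [DecidableEq P] (π : Perm P) (h : P → A)
    (hsum : ∀ c, ∑ p with π.SameCycle c p, h p = 0) :
    ∃ φ : P → A, ∀ p, φ p = φ (π.symm p) + h p := by
  have hle : ∀ (b : P) (k d : ℕ), (π ^ k) b = (π ^ (k + d)) b →
      ∑ j ∈ Finset.range k, h ((π ^ (j + 1)) b) =
        ∑ j ∈ Finset.range (k + d), h ((π ^ (j + 1)) b) := by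
    intro b k d hkd
    rw [add_comm k d, pow_add, mul_apply] at hkd
    rw [Finset.sum_range_add, left_eq_add, ← sum_range_pow_eq_zero hsum hkd.symm]
    refine Finset.sum_congr rfl fun j _ => congrArg h ?_
    rw [show k + j + 1 = (j + 1) + k by ring, pow_add, mul_apply]
  have heq : ∀ (b : P) (k l : ℕ), (π ^ k) b = (π ^ l) b →
      ∑ j ∈ Finset.range k, h ((π ^ (j + 1)) b) =
        ∑ j ∈ Finset.range l, h ((π ^ (j + 1)) b) := by
    intro b k l hkl
    rcases le_total k l with hk | hk
    · obtain ⟨d, rfl⟩ := Nat.exists_eq_add_of_le hk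
      exact hle b k d hkl
    · obtain ⟨d, rfl⟩ := Nat.exists_eq_add_of_le hk
      exact (hle b l d hkl.symm).symm
  -- The potential at `p` is the partial sum from a fixed representative of its cycle up to `p`; by
  -- `heq` it does not depend on the exponent chosen to reach `p`.
  let rep : P → P := fun p => (Quotient.mk (SameCycle.setoid π) p).out
  have hrep : ∀ p, π.SameCycle (rep p) p := fun p =>
    Quotient.exact (Quotient.out_eq (Quotient.mk (SameCycle.setoid π) p))
  have hrep' : ∀ p, rep (π.symm p) = rep p := fun p =>
    congrArg Quotient.out (Quotient.sound (s := SameCycle.setoid π) ⟨1, by simp⟩)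
  choose k hk using fun p => (hrep p).exists_nat_pow_eq
  refine ⟨fun p => ∑ j ∈ Finset.range (k p), h ((π ^ (j + 1)) (rep p)), fun p => ?_⟩
  have hp : (π ^ (k (π.symm p) + 1)) (rep p) = p := by
    rw [pow_succ', mul_apply, ← hrep' p, hk, apply_symm_apply]
  dsimp only
  rw [heq (rep p) (k p) (k (π.symm p) + 1) ((hk p).trans hp.symm), Finset.sum_range_succ, hp,
    hrep']

/-- A cycle of length `n` is conjugate to adding one in `ZMod n`. -/
theorem IsCycleOn.exists_equiv_zmod {n : ℕ} [NeZero n] {σ : Perm (Fin n)}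
    (hσ : σ.IsCycleOn _root_.Set.univ) : ∃ e : Fin n ≃ ZMod n, ∀ i, e (σ i) = e i + 1 := by
  have hσ' : σ.IsCycleOn ((Finset.univ : Finset (Fin n)) : Set (Fin n)) := by simpa using hσ
  choose k _ hk using fun i =>
    hσ'.exists_pow_eq (a := (0 : Fin n)) (b := i) (Finset.mem_univ _) (Finset.mem_univ _)
  have hmod : ∀ a b : ℕ, (σ ^ a) 0 = (σ ^ b) 0 ↔ (a : ZMod n) = b := fun a b => by
    rw [hσ'.pow_apply_eq_pow_apply (Finset.mem_univ _), Finset.card_univ, Fintype.card_fin,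
      ZMod.natCast_eq_natCast_iff]
  have hinj : Function.Injective fun i => (k i : ZMod n) := fun i j hij => by
    rw [← hk i, ← hk j]
    exact (hmod _ _).2 hij
  refine ⟨Equiv.ofBijective _ ((Fintype.bijective_iff_injective_and_card _).2 ⟨hinj, by simp⟩),
    fun i => ?_⟩
  change (k (σ i) : ZMod n) = k i + 1
  rw [← Nat.cast_succ, ← hmod, hk, pow_succ', mul_apply, hk]

end Equiv.Perm

/-! ### Additive coordinates on the quandle -/

namespace PQuandle

variable {n : ℕ} {σ : Equiv.Perm (Fin n)}

theorem exponent_eq_ite (x y : PQuandle σ) :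
    exponent σ x y = if x = zero σ ∧ y ≠ zero σ then 1 else 0 := by
  rcases x with _ | i <;> rcases y with _ | j
  · exact (exponent_zero_zero σ).trans (if_neg fun h => h.2 rfl).symm
  · exact (exponent_zero_pos σ j).trans (if_pos ⟨rfl, Option.some_ne_none j⟩).symm
  · exact (exponent_pos σ i _).trans (if_neg fun h => Option.some_ne_none i h.1).symm
  · exact (exponent_pos σ i _).trans (if_neg fun h => Option.some_ne_none i h.1).symm

/-- The value in `ZMod n` of a color, where `0` is sent to `0`. -/
def value (e : Fin n ≃ ZMod n) : PQuandle σ → ZMod n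
  | none => 0
  | some i => e i

variable {e : Fin n ≃ ZMod n}

theorem value_injOn {x y : PQuandle σ} (hx : x ≠ zero σ) (hy : y ≠ zero σ)
    (h : value e x = value e y) : x = y := by
  rcases x with _ | i
  · exact absurd rfl hx
  rcases y with _ | j
  · exact absurd rfl hy
  exact congrArg some (e.injective h)

theorem act_eq_zero_iff (x y : PQuandle σ) : Shelf.act y x = zero σ ↔ x = zero σ := by
  rcases x with _ | i <;> rcases y with _ | j
  · exact Iff.rfl
  · exact Iff.rfl
  · exact ⟨fun h => absurd h (Option.some_ne_none _), fun h => absurd h (Option.some_ne_none _)⟩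
  · exact Iff.rfl

theorem value_act (he : ∀ i, e (σ i) = e i + 1) {x : PQuandle σ} (hx : x ≠ zero σ)
    (y : PQuandle σ) :
    value e (Shelf.act y x) = value e x + if y = zero σ then 1 else 0 := by
  rcases x with _ | i
  · exact absurd rfl hx
  rcases y with _ | j
  · exact (he i).trans (congrArg (e i + ·) (if_pos rfl).symm)
  · exact (add_zero (e i)).symm.trans
      (congrArg (e i + ·) (if_neg (Option.some_ne_none j)).symm)

theorem act_eq_iff (he : ∀ i, e (σ i) = e i + 1) (x y z : PQuandle σ) :
    Shelf.act y x = z ↔ (z = zero σ ↔ x = zero σ) ∧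
      (z ≠ zero σ → value e z = value e x + if y = zero σ then 1 else 0) := by
  constructor
  · rintro rfl
    rw [Ne, act_eq_zero_iff]
    exact ⟨Iff.rfl, fun hx => value_act he hx y⟩
  · rintro ⟨h1, h2⟩
    by_cases hz : z = zero σ
    · rw [hz, act_eq_zero_iff, ← h1, hz]
    · have hx : x ≠ zero σ := fun h => hz (h1.2 h)
      exact value_injOn (mt (act_eq_zero_iff x y).1 hx) hz
        ((value_act he hx y).trans (h2 hz).symm)

/-- Here `x` and `z` are the arriving and the leaving under color. At a negative crossing source and
target are exchanged, so adding 1 from source to target means subtracting 1 along the orientation;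
both signs obey one rule. -/
theorem crossing_condition_iff (he : ∀ i, e (σ i) = e i + 1) (ε : ℤˣ) (x y z : PQuandle σ) :
    ((if ε = 1 then z else x) = Shelf.act y (if ε = 1 then x else z)) ↔
      (z = zero σ ↔ x = zero σ) ∧
      (z ≠ zero σ → value e z = value e x + if y = zero σ then ((ε : ℤ) : ZMod n) else 0) := by
  rcases Int.units_eq_one_or ε with rfl | rfl
  · rw [if_pos rfl, if_pos rfl, eq_comm, act_eq_iff he]
    simp
  · rw [if_neg (by decide), if_neg (by decide), eq_comm, act_eq_iff he]
    constructor
    · rintro ⟨h1, h2⟩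
      refine ⟨h1.symm, fun hz => ?_⟩
      rw [h2 (mt h1.1 hz)]
      split_ifs <;> simp
    · rintro ⟨h1, h2⟩
      refine ⟨h1.symm, fun hx => ?_⟩
      rw [h2 (mt h1.1 hx)]
      split_ifs <;> simp

end PQuandle

/-! ### Colorings described by base colors -/

namespace GaussCode

variable {m : ℕ} (D : GaussCode m)

theorem eq_of_component_eq {T : Type*} (g : D.Passage → T) (hg : ∀ p, g p = g (D.next.symm p))
    {p q : D.Passage} (h : D.component p = D.component q) : g p = g q := by
  obtain ⟨k, rfl⟩ := ((D.component_eq_iff p q).1 h).exists_nat_pow_eq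
  clear h
  induction k with
  | zero => rfl
  | succ k ih => rw [ih, pow_succ', Equiv.Perm.mul_apply, hg (D.next _), Equiv.symm_apply_apply]

end GaussCode

namespace LinkDiagram

variable {m : ℕ} (D : LinkDiagram m)

/-- The component to which an edge belongs. -/
def edgeComponent : D.Edge → Fin m := Sum.elim D.component Subtype.val

theorem exists_edgeComponent_eq (i : Fin m) : ∃ a, D.edgeComponent a = i := by
  by_cases h : ∃ p, D.component p = i
  · exact h.imp' Sum.inl fun _ => id
  · exact ⟨Sum.inr ⟨i, not_exists.1 h⟩, rfl⟩

theorem eq_of_edgeComponent_eq {T : Type*} (g : D.Edge → T)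
    (hg : ∀ p, g (Sum.inl p) = g (Sum.inl (D.next.symm p)))
    {a b : D.Edge} (h : D.edgeComponent a = D.edgeComponent b) : g a = g b := by
  rcases a with p | ⟨i, hi⟩ <;> rcases b with q | ⟨j, hj⟩
  · exact D.eq_of_component_eq (fun p => g (Sum.inl p)) hg h
  · exact absurd h (hj p)
  · exact absurd h.symm (hi q)
  · obtain rfl : i = j := h
    rfl

/-- The exponent of `σ` that a color acquires on passing through a crossing, if the components in
`Z` have color `0`. -/
def increment (Z : Fin m → Prop) [DecidablePred Z] : D.Passage → ℤ
  | (_, .over) => 0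
  | (c, .under) => if Z (D.component (c, .over)) then (D.sign c : ℤ) else 0

theorem sum_increment (Z : Fin m → Prop) [DecidablePred Z] (i : Fin m) :
    ∑ p with D.component p = i, D.increment Z p = ∑ j with Z j, D.signedUnder i j := by
  simp only [signedUnder, Finset.sum_filter (s := (Finset.univ : Finset D.Crossing))]
  rw [Finset.sum_comm, Finset.sum_filter, Fintype.sum_prod_type]
  refine Finset.sum_congr rfl fun c _ => ?_
  simp [GaussCode.sum_strand, increment, ite_and, Finset.sum_ite_eq]

theorem sum_sum_signedUnder (Y Z : Fin m → Prop) [DecidablePred Y] [DecidablePred Z] :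
    ∑ i with Y i, ∑ j with Z j, D.signedUnder i j =
      ∑ c, if Y (D.component (c, .under)) ∧ Z (D.component (c, .over)) then (D.sign c : ℤ)
        else 0 := by
  simp only [← sum_increment]
  rw [Finset.sum_filter]
  simp only [Finset.sum_filter (s := (Finset.univ : Finset D.Passage)), ← Finset.sum_filter Y]
  rw [Finset.sum_comm, Fintype.sum_prod_type]
  refine Finset.sum_congr rfl fun c _ => ?_
  simp [GaussCode.sum_strand, increment, ite_and, Finset.sum_ite_eq]

section Coloring

variable {n : ℕ} {σ : Equiv.Perm (Fin n)}

open PQuandle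

/-- The color of an edge. -/
def edgeColor {X : Type} [Quandle X] (f : D.Coloring X) (a : D.Edge) : X := f.1 (Quot.mk _ a)

theorem edgeColor_over {X : Type} [Quandle X] (f : D.Coloring X) (c : D.Crossing) :
    D.edgeColor f (Sum.inl (c, .over)) = D.edgeColor f (Sum.inl (D.next.symm (c, .over))) :=
  congrArg f.1 (Quot.sound (r := D.JoinedOver) ⟨c, rfl, rfl⟩).symm

theorem edgeColor_under {X : Type} [Quandle X] (f : D.Coloring X) (c : D.Crossing) :
    (if D.sign c = 1 then D.edgeColor f (Sum.inl (c, .under))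
      else D.edgeColor f (Sum.inl (D.next.symm (c, .under)))) =
    Shelf.act (D.edgeColor f (Sum.inl (c, .over)))
      (if D.sign c = 1 then D.edgeColor f (Sum.inl (D.next.symm (c, .under)))
        else D.edgeColor f (Sum.inl (c, .under))) := by
  have h := f.2 c
  unfold targetArc sourceArc at h
  by_cases hc : D.sign c = 1
  · simp only [if_pos hc] at h ⊢
    exact h
  · simp only [if_neg hc] at h ⊢
    exact h

/-- Colorings of the edges that are compatible with all crossings descend to the arcs. -/
theorem exists_coloring {X : Type} [Quandle X] (F : D.Edge → X)
    (hover : ∀ c, F (Sum.inl (c, .over)) = F (Sum.inl (D.next.symm (c, .over))))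
    (hunder : ∀ c, (if D.sign c = 1 then F (Sum.inl (c, .under))
      else F (Sum.inl (D.next.symm (c, .under)))) =
    Shelf.act (F (Sum.inl (c, .over)))
      (if D.sign c = 1 then F (Sum.inl (D.next.symm (c, .under)))
        else F (Sum.inl (c, .under)))) :
    ∃ f : D.Coloring X, D.edgeColor f = F := by
  refine ⟨⟨Quot.lift F ?_, fun c => ?_⟩, rfl⟩
  · rintro _ _ ⟨c, rfl, rfl⟩
    exact (hover c).symm
  · have h := hunder c
    unfold targetArc sourceArc
    by_cases hc : D.sign c = 1
    · simp only [if_pos hc] at h ⊢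
      exact h
    · simp only [if_neg hc] at h ⊢
      exact h

variable {D}

theorem edgeColor_injective {X : Type} [Quandle X] {f g : D.Coloring X}
    (h : D.edgeColor f = D.edgeColor g) : f = g :=
  Subtype.ext (funext fun x => Quot.inductionOn x (congrFun h))

variable {e : Fin n ≃ ZMod n}

theorem edgeColor_eq_zero_iff_prev (he : ∀ i, e (σ i) = e i + 1) (f : D.Coloring (PQuandle σ))
    (p : D.Passage) :
    D.edgeColor f (Sum.inl p) = zero σ ↔ D.edgeColor f (Sum.inl (D.next.symm p)) = zero σ := by
  obtain ⟨c, _ | _⟩ := p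
  · rw [edgeColor_over]
  · exact ((crossing_condition_iff he _ _ _ _).1 (D.edgeColor_under f c)).1

theorem edgeColor_eq_zero_iff (he : ∀ i, e (σ i) = e i + 1) (f : D.Coloring (PQuandle σ))
    {a b : D.Edge} (h : D.edgeComponent a = D.edgeComponent b) :
    D.edgeColor f a = zero σ ↔ D.edgeColor f b = zero σ :=
  iff_of_eq (D.eq_of_edgeComponent_eq (fun a => D.edgeColor f a = zero σ)
    (fun p => propext (edgeColor_eq_zero_iff_prev he f p)) h)

variable {base : Fin m → D.Edge} (hbase : ∀ i, D.edgeComponent (base i) = i)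
include hbase

theorem edgeColor_eq_zero_iff_base (he : ∀ i, e (σ i) = e i + 1) (f : D.Coloring (PQuandle σ))
    (a : D.Edge) :
    D.edgeColor f a = zero σ ↔ D.edgeColor f (base (D.edgeComponent a)) = zero σ :=
  edgeColor_eq_zero_iff he f (hbase _).symm

theorem value_edgeColor (he : ∀ i, e (σ i) = e i + 1) (f : D.Coloring (PQuandle σ))
    {p : D.Passage} (hp : D.edgeColor f (Sum.inl p) ≠ zero σ) :
    value e (D.edgeColor f (Sum.inl p)) = value e (D.edgeColor f (Sum.inl (D.next.symm p))) +
      (D.increment (fun i => D.edgeColor f (base i) = zero σ) p : ZMod n) := by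
  obtain ⟨c, _ | _⟩ := p
  · rw [edgeColor_over, increment, Int.cast_zero, add_zero]
  · rw [((crossing_condition_iff he _ _ _ _).1 (D.edgeColor_under f c)).2 hp, increment]
    simp only [edgeColor_eq_zero_iff_base hbase he f (Sum.inl (c, .over)), edgeComponent,
      Sum.elim_inl]
    split_ifs <;> simp

/-- One full turn around component `i` returns to the same value, so the increments sum to 0 in
`ZMod n`. -/
theorem dvd_of_edgeColor_ne_zero (he : ∀ i, e (σ i) = e i + 1) (f : D.Coloring (PQuandle σ))
    {i : Fin m} (hi : D.edgeColor f (base i) ≠ zero σ) :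
    (n : ℤ) ∣ ∑ j with D.edgeColor f (base j) = zero σ, D.signedUnder i j := by
  rw [← sum_increment, ← ZMod.intCast_zmod_eq_zero_iff_dvd, Int.cast_sum,
    ← D.sum_component_sub_prev i fun p => value e (D.edgeColor f (Sum.inl p))]
  refine Finset.sum_congr rfl fun p hp => ?_
  rw [value_edgeColor hbase he f (p := p), add_sub_cancel_left]
  rwa [Ne, edgeColor_eq_zero_iff he f (b := base i)]
  rw [hbase]
  exact (Finset.mem_filter.1 hp).2

/-- Both colorings have the same `0`-components, hence the same increments; the difference of their
values is constant on each component and vanishes at the base edge. -/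
theorem coloring_ext_base (he : ∀ i, e (σ i) = e i + 1) {f g : D.Coloring (PQuandle σ)}
    (h : ∀ i, D.edgeColor f (base i) = D.edgeColor g (base i)) : f = g := by
  refine edgeColor_injective (funext fun a => ?_)
  by_cases ha : D.edgeColor f a = zero σ
  · have hg : D.edgeColor g a = zero σ := by
      rwa [edgeColor_eq_zero_iff_base hbase he, ← h, ← edgeColor_eq_zero_iff_base hbase he]
    rw [ha, hg]
  have hzero : ∀ b, D.edgeColor g b = zero σ ↔ D.edgeColor f b = zero σ := fun b => by
    rw [edgeColor_eq_zero_iff_base hbase he, ← h, ← edgeColor_eq_zero_iff_base hbase he]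
  refine value_injOn (e := e) ha (mt (hzero a).1 ha) (sub_eq_zero.1 ?_)
  have key := D.eq_of_edgeComponent_eq
    (fun b => value e (D.edgeColor f b) - value e (D.edgeColor g b)) (fun p => by
      -- On `0`-edges both values are the default 0, so the difference is trivially constant there.
      by_cases hp : D.edgeColor f (Sum.inl p) = zero σ
      · have hp' := (edgeColor_eq_zero_iff_prev he f p).1 hp
        simp only [hp, hp', (hzero _).2 hp, (hzero _).2 hp']
      · simp only [value_edgeColor hbase he f hp,
          value_edgeColor hbase he g (mt (hzero _).1 hp), h]
        ring) (hbase (D.edgeComponent a)).symm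
  exact key.trans (by simp only [h, sub_self])

theorem exists_coloring_of_dvd (he : ∀ i, e (σ i) = e i + 1) (v : Fin m → PQuandle σ)
    (hv : ∀ i, v i ≠ zero σ → (n : ℤ) ∣ ∑ j with v j = zero σ, D.signedUnder i j) :
    ∃ f : D.Coloring (PQuandle σ), ∀ i, D.edgeColor f (base i) = v i := by
  classical
  -- Increments on `0`-components are replaced by 0, since `hv` says nothing about their sum.
  obtain ⟨φ, hφ⟩ := Equiv.Perm.exists_potential D.next
    (fun p => if v (D.component p) = zero σ then (0 : ZMod n)
      else (D.increment (fun i => v i = zero σ) p : ZMod n)) (by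
    intro q
    simp only [← D.component_eq_iff, eq_comm (a := D.component q)]
    by_cases hq : v (D.component q) = zero σ
    · exact Finset.sum_eq_zero fun p hp => if_pos (by rwa [(Finset.mem_filter.1 hp).2])
    · rw [← (ZMod.intCast_zmod_eq_zero_iff_dvd _ _).2 (hv _ hq), ← sum_increment, Int.cast_sum]
      exact Finset.sum_congr rfl fun p hp => if_neg (by rwa [(Finset.mem_filter.1 hp).2]))
  -- A component without crossings has a single edge, so any constant serves there. `val` then
  -- shifts the potential on each component to take the prescribed value at the base edge.
  let ψ : D.Edge → ZMod n := Sum.elim φ 0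
  let val : D.Edge → ZMod n := fun a =>
    ψ a - ψ (base (D.edgeComponent a)) + value e (v (D.edgeComponent a))
  let F : D.Edge → PQuandle σ := fun a =>
    if v (D.edgeComponent a) = zero σ then zero σ else pos σ (e.symm (val a))
  have hF : ∀ a, F a = zero σ ↔ v (D.edgeComponent a) = zero σ := fun a =>
    ⟨fun h => by_contra fun h' => Option.some_ne_none _ ((if_neg h').symm.trans h),
      fun h => if_pos h⟩
  have hvalF : ∀ a, F a ≠ zero σ → value e (F a) = val a := fun a ha => by
    simp only [F, if_neg (mt (hF a).2 ha)]
    exact e.apply_symm_apply _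
  have hprev : ∀ p, (F (Sum.inl p) = zero σ ↔ F (Sum.inl (D.next.symm p)) = zero σ) ∧
      (F (Sum.inl p) ≠ zero σ → value e (F (Sum.inl p)) =
        value e (F (Sum.inl (D.next.symm p))) +
          (D.increment (fun i => v i = zero σ) p : ZMod n)) := by
    intro p
    have h0 : F (Sum.inl p) = zero σ ↔ F (Sum.inl (D.next.symm p)) = zero σ := by
      simp only [hF, edgeComponent, Sum.elim_inl, D.component_next_symm]
    refine ⟨h0, fun hp => ?_⟩
    rw [hvalF _ hp, hvalF _ (mt h0.2 hp)]
    have hp' : v (D.component p) ≠ zero σ := fun h => hp ((hF (Sum.inl p)).2 h)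
    simp only [val, ψ, edgeComponent, Sum.elim_inl, D.component_next_symm]
    rw [hφ p, if_neg hp']
    ring
  obtain ⟨f, hf⟩ := D.exists_coloring F (fun c => by
    have h := hprev (c, .over)
    by_cases hc : F (Sum.inl (c, .over)) = zero σ
    · rw [hc, h.1.1 hc]
    · refine value_injOn hc (mt h.1.2 hc) ((h.2 hc).trans ?_)
      rw [increment, Int.cast_zero, add_zero]) (fun c => by
    refine (crossing_condition_iff he _ _ _ _).2 ⟨(hprev (c, .under)).1, fun hc => ?_⟩
    rw [(hprev (c, .under)).2 hc, increment]
    simp only [hF, edgeComponent, Sum.elim_inl]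
    split_ifs <;> simp)
  refine ⟨f, fun i => ?_⟩
  rw [hf]
  by_cases hi : v i = zero σ
  · rw [hi, hF, hbase, hi]
  · have hFi : F (base i) ≠ zero σ := by rwa [Ne, hF, hbase]
    refine value_injOn hFi hi ((hvalF _ hFi).trans ?_)
    simp only [val, hbase, sub_self, zero_add]

/-- A crossing contributes its sign exactly when the under component is `0` and the over component
is not. Source and arriving or leaving under edge need not be distinguished, as they vanish
together. -/
theorem weight_theta (he : ∀ i, e (σ i) = e i + 1) (f : D.Coloring (PQuandle σ)) :
    D.weight (theta σ) f = Multiplicative.ofAdd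
      (∑ i with D.edgeColor f (base i) = zero σ,
        ∑ j with D.edgeColor f (base j) ≠ zero σ, D.signedUnder i j) := by
  rw [sum_sum_signedUnder, ofAdd_sum]
  refine Finset.prod_congr rfl fun c _ => ?_
  have hsource : f.1 (D.sourceArc c) = zero σ ↔
      D.edgeColor f (base (D.component (c, .under))) = zero σ := by
    refine Iff.trans ?_ (edgeColor_eq_zero_iff_base hbase he f (Sum.inl (c, .under)))
    unfold sourceArc
    split_ifs
    · exact (edgeColor_eq_zero_iff_prev he f (c, .under)).symm
    · rfl
  have hover : f.1 (D.overArc c) = zero σ ↔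
      D.edgeColor f (base (D.component (c, .over))) = zero σ :=
    edgeColor_eq_zero_iff_base hbase he f (Sum.inl (c, .over))
  change Multiplicative.ofAdd (exponent σ _ _) ^ (D.sign c : ℤ) = _
  rw [← ofAdd_zsmul, exponent_eq_ite]
  simp only [hsource, hover, Ne]
  split_ifs <;> simp

omit hbase

variable (D)

theorem cocycleInvariant_theta [NeZero n] (hσ : σ.IsCycleOn Set.univ) :
    D.cocycleInvariant (theta σ) = ∑ v : Fin m → PQuandle σ,
      if ∀ i, v i ≠ zero σ → (n : ℤ) ∣ ∑ j with v j = zero σ, D.signedUnder i j then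
        tPow (∑ i with v i = zero σ, ∑ j with v j ≠ zero σ, D.signedUnder i j) else 0 := by
  obtain ⟨e, he⟩ := hσ.exists_equiv_zmod
  choose base hbase using D.exists_edgeComponent_eq
  rw [← Finset.sum_filter]
  refine Finset.sum_bij (fun f _ i => D.edgeColor f (base i)) (fun f _ => ?_)
    (fun f _ g _ h => coloring_ext_base hbase he (congrFun h)) (fun v hv => ?_) (fun f _ => ?_)
  · exact Finset.mem_filter.2 ⟨Finset.mem_univ _, fun i => dvd_of_edgeColor_ne_zero hbase he f⟩
  · obtain ⟨f, hf⟩ := exists_coloring_of_dvd hbase he v (Finset.mem_filter.1 hv).2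
    exact ⟨f, Finset.mem_univ _, funext hf⟩
  · rw [weight_theta hbase he f, tPow]

end Coloring

end LinkDiagram

/-! ### Two components -/

theorem tPow_zero : tPow 0 = 1 := map_one _

namespace PQuandle

variable {n : ℕ} {σ : Equiv.Perm (Fin n)}

theorem pos_ne_zero (i : Fin n) : pos σ i ≠ zero σ := Option.some_ne_none i

theorem sum_eq_zero_add_sum_pos {M : Type*} [AddCommMonoid M] (g : PQuandle σ → M) :
    ∑ x, g x = g (zero σ) + ∑ i, g (pos σ i) :=
  Fintype.sum_option g

end PQuandle

namespace LinkDiagram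

open PQuandle

/-- The four terms are the base colors `(0, 0)`, (positive, positive), `(0, positive)` and
`(positive, 0)`. Without a `0`-component no color changes, so the second case carries no condition.
-/
theorem cocycleInvariant_theta_two (D : LinkDiagram 2) {n : ℕ} [NeZero n]
    {σ : Equiv.Perm (Fin n)} (hσ : σ.IsCycleOn Set.univ) :
    D.cocycleInvariant (theta σ) =
      tPow 0 + (n : MonoidAlgebra ℤ (Multiplicative ℤ)) ^ 2 * tPow 0 +
        (n : MonoidAlgebra ℤ (Multiplicative ℤ)) *
          (if (n : ℤ) ∣ D.signedUnder 1 0 then tPow (D.signedUnder 0 1) else 0) +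
        (n : MonoidAlgebra ℤ (Multiplicative ℤ)) *
          (if (n : ℤ) ∣ D.signedUnder 0 1 then tPow (D.signedUnder 1 0) else 0) := by
  rw [D.cocycleInvariant_theta hσ]
  simp only [Finset.sum_filter, Fin.sum_univ_two, Fin.forall_fin_two]
  rw [← (finTwoArrowEquiv (PQuandle σ)).symm.sum_comp, Fintype.sum_prod_type]
  simp [sum_eq_zero_add_sum_pos, pos_ne_zero]
  ring

end LinkDiagram

theorem mainTheorem6 (n : ℕ) (hn : 1 ≤ n) (σ : Equiv.Perm (Fin n))
    (hσ : σ.IsCycleOn Set.univ) :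
    (∀ D D' : LinkDiagram 2, D.linkingNumber 0 1 = D'.linkingNumber 0 1 →
      D.cocycleInvariant (PQuandle.theta σ) = D'.cocycleInvariant (PQuandle.theta σ)) ∧
    ∀ D : LinkDiagram 2,
      D.linkingNumber 0 1 = D.signedUnder 0 1 ∧
      D.linkingNumber 0 1 = D.signedUnder 1 0 ∧
      ((n : ℤ) ∣ D.linkingNumber 0 1 →
        D.cocycleInvariant (PQuandle.theta σ) =
          1 + (n : MonoidAlgebra ℤ (Multiplicative ℤ)) ^ 2
            + 2 * (n : MonoidAlgebra ℤ (Multiplicative ℤ)) * tPow (D.linkingNumber 0 1)) ∧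
      (¬ (n : ℤ) ∣ D.linkingNumber 0 1 →
        D.cocycleInvariant (PQuandle.theta σ) =
          1 + (n : MonoidAlgebra ℤ (Multiplicative ℤ)) ^ 2) := by
  have : NeZero n := ⟨by omega⟩
  have hlk : ∀ D : LinkDiagram 2,
      D.linkingNumber 0 1 = D.signedUnder 0 1 ∧ D.linkingNumber 0 1 = D.signedUnder 1 0 := by
    intro D
    have h := D.signedUnder_symm 0 1
    unfold LinkDiagram.linkingNumber
    -- Equality of the two counts makes the integer division by 2 exact.
    omega
  have hval : ∀ D : LinkDiagram 2, D.cocycleInvariant (PQuandle.theta σ) =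
      1 + (n : MonoidAlgebra ℤ (Multiplicative ℤ)) ^ 2 +
        if (n : ℤ) ∣ D.linkingNumber 0 1 then
          2 * (n : MonoidAlgebra ℤ (Multiplicative ℤ)) * tPow (D.linkingNumber 0 1) else 0 := by
    intro D
    rw [D.cocycleInvariant_theta_two hσ, ← (hlk D).1, ← (hlk D).2, tPow_zero]
    split_ifs <;> ring
  refine ⟨fun D D' h => by rw [hval, hval, h], fun D =>
    ⟨(hlk D).1, (hlk D).2, fun h => ?_, fun h => ?_⟩⟩
  · rw [hval, if_pos h]
  · rw [hval, if_neg h, add_zero]
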